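/- For $p\geq 2$ let $\mathfrak l_p$ be the real Lie algebra with basis $x_1,\dots,x_p$ whose only nonzero brackets of basis elements are, up to antisymmetry, $[x_1,x_i]=x_{i+1}$ for $2\leq i\leq p-1$ (so $\mathfrak l_2=\mathbf R^2$), and let $L_p$ be the corresponding simply connected Lie group. For $p\geq q\geq 2$ let $G_{p,q}$ be the central product of $L_p$ and $L_q$, that is, the quotient of $L_p\times L_q$ by the central subgroup $\{(\exp(c\,x_p),\exp(-c\,y_q)) : c\in\mathbf R\}$, where $y_1,\dots,y_q$ denotes the given basis of $\mathfrak l_q$; it is a simply connected nilpotent Lie group. A compact presentation $\langle S\mid R\rangle$ of $G_{p,q}$ consists of a compact generating set $S\subseteq G_{p,q}$ and a set $R$ of elements of bounded word length in the free group $F_S$ whose normal closure is the kernel of $F_S\to G_{p,q}$. For $w$ in this kernel let $\operatorname{Area}(w)$ be the least $k$ such that $w=\prod_{i=1}^k u_i^{-1}r_iu_i$ with $u_i\in F_S$ and $r_i\in R^{\pm1}$. The Dehn function $\delta_{\langle S\mid R\rangle}(n)\in\mathbf Z_{\geq 0}\cup\{\infty\}$ is the supremum of $\operatorname{Area}(w)$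 over all $w$ in the kernel whose freely reduced form has length at most $n$. Theorem. Let $p\geq q\geq 2$. The Dehn function of $G_{p,q}$ is $\succcurlyeq n^{p-1}$; that is, for every compact presentation $\langle S\mid R\rangle$ of $G_{p,q}$ there is a constant $A\in\mathbf Z_{\geq 0}$ such that, for all integers $n\geq 0$, $$n^{p-1}\leq A\,\delta_{\langle S\mid R\rangle}(An+A)+A .$$ -/

import Mathlib

/-! ### The model filiform groups -/

/-- The operator `ad x₁` of the model filiform Lie algebra `𝔩_p`, restricted to its abelian ideal
`span (x₂, …, x_p)`.  The coordinate with index `i : Fin (p - 1)` is the coefficient of `x_{i+2}`;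
the operator sends `x_j` to `x_{j+1}` for `2 ≤ j < p` and `x_p` to `0`. -/
def filiformShift (p : ℕ) : Module.End ℝ (Fin (p - 1) → ℝ) where
  toFun v i := if h : (i : ℕ) = 0 then 0 else v ⟨(i : ℕ) - 1, by have := i.isLt; omega⟩
  map_add' v w := by
    funext i
    by_cases h : (i : ℕ) = 0 <;> simp [h]
  map_smul' c v := by
    funext i
    by_cases h : (i : ℕ) = 0 <;> simp [h]

theorem filiformShift_pow_apply_eq_zero (p k : ℕ) (v : Fin (p - 1) → ℝ) (i : Fin (p - 1))
    (hi : (i : ℕ) < k) : (filiformShift p ^ k) v i = 0 := by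
  induction k generalizing i with
  | zero => omega
  | succ k ih =>
    rw [pow_succ', Module.End.mul_apply]
    by_cases h : (i : ℕ) = 0
    · simp [filiformShift, h]
    · simp only [filiformShift, LinearMap.coe_mk, AddHom.coe_mk, h, dite_false]
      exact ih _ (by simp only; omega)

theorem filiformShift_pow (p : ℕ) : filiformShift p ^ p = 0 := by
  ext1 v
  ext i
  simpa using filiformShift_pow_apply_eq_zero p p _ i (by have := i.isLt; omega)

/-- The operator `exp (t · ad x₁)` on `span (x₂, …, x_p)`; since `(ad x₁) ^ p = 0`, the exponential
series is a finite sum. -/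
noncomputable def filiformExp (p : ℕ) (t : ℝ) : Module.End ℝ (Fin (p - 1) → ℝ) :=
  ∑ k ∈ Finset.range p, (t ^ k / (k.factorial : ℝ)) • filiformShift p ^ k

theorem filiformExp_eq_exp (p : ℕ) (t : ℝ) :
    filiformExp p t = IsNilpotent.exp (t • filiformShift p) := by
  have h : (t • filiformShift p) ^ p = 0 := by rw [smul_pow, filiformShift_pow, smul_zero]
  rw [IsNilpotent.exp_eq_sum h, filiformExp]
  refine Finset.sum_congr rfl fun k _ => ?_
  rw [smul_pow]
  ext1 v
  ext i
  simp [Rat.smul_def]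
  ring

theorem filiformExp_add (p : ℕ) (s t : ℝ) :
    filiformExp p (s + t) = filiformExp p s * filiformExp p t := by
  have h (r : ℝ) : IsNilpotent (r • filiformShift p) :=
    ⟨p, by rw [smul_pow, filiformShift_pow, smul_zero]⟩
  rw [filiformExp_eq_exp, filiformExp_eq_exp, filiformExp_eq_exp, add_smul,
    IsNilpotent.exp_add_of_commute _ (h s) (h t)]
  exact ((Commute.refl (filiformShift p)).smul_left s).smul_right t

theorem filiformExp_zero (p : ℕ) : filiformExp p 0 = 1 := by
  rw [filiformExp_eq_exp, zero_smul, IsNilpotent.exp_zero]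

/-- The simply connected Lie group `L_p` of the model filiform Lie algebra `𝔩_p`, which has the
basis `x₁, …, x_p` and the nonzero brackets `[x₁, x_i] = x_{i+1}` (`2 ≤ i ≤ p - 1`).
As `𝔩_p` is the semidirect product of `ℝ x₁` and the abelian ideal `span (x₂, …, x_p)`, the group
`L_p` is the semidirect product of `ℝ` and `ℝ^{p-1}` in which `t : ℝ` acts by `exp (t · ad x₁)`.
The pair `(t, v)` stands for `exp (v₂ x₂ + … + v_p x_p) · exp (t x₁)`. -/
@[ext]
structure FiliformGroup (p : ℕ) where
  /-- the coordinate along `x₁` -/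
  t : ℝ
  /-- the coordinates along `x₂, …, x_p` -/
  v : Fin (p - 1) → ℝ

namespace FiliformGroup

variable {p : ℕ}

noncomputable instance : Mul (FiliformGroup p) :=
  ⟨fun a b => ⟨a.t + b.t, a.v + filiformExp p a.t b.v⟩⟩

instance : One (FiliformGroup p) := ⟨⟨0, 0⟩⟩

noncomputable instance : Inv (FiliformGroup p) := ⟨fun a => ⟨-a.t, -(filiformExp p (-a.t) a.v)⟩⟩

@[simp] theorem mul_t (a b : FiliformGroup p) : (a * b).t = a.t + b.t := rfl

@[simp] theorem mul_v (a b : FiliformGroup p) : (a * b).v = a.v + filiformExp p a.t b.v := rfl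

@[simp] theorem one_t : (1 : FiliformGroup p).t = 0 := rfl

@[simp] theorem one_v : (1 : FiliformGroup p).v = 0 := rfl

@[simp] theorem inv_t (a : FiliformGroup p) : (a⁻¹).t = -a.t := rfl

@[simp] theorem inv_v (a : FiliformGroup p) : (a⁻¹).v = -(filiformExp p (-a.t) a.v) := rfl

noncomputable instance : Group (FiliformGroup p) :=
  Group.ofLeftAxioms
    (fun a b c => by
      ext1
      · simp [add_assoc]
      · simp [filiformExp_add, add_assoc])
    (fun a => by ext1 <;> simp [filiformExp_zero])
    (fun a => by ext1 <;> simp)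

/-- The global coordinates on `L_p`. -/
def coords (p : ℕ) : FiliformGroup p ≃ ℝ × (Fin (p - 1) → ℝ) where
  toFun a := (a.t, a.v)
  invFun x := ⟨x.1, x.2⟩

/-- The topology of `L_p` is the one that makes the global coordinates a homeomorphism. -/
instance : TopologicalSpace (FiliformGroup p) := TopologicalSpace.induced (coords p) inferInstance

theorem continuous_t : Continuous (t : FiliformGroup p → ℝ) :=
  continuous_fst.comp (continuous_induced_dom (f := coords p))

theorem continuous_v : Continuous (v : FiliformGroup p → Fin (p - 1) → ℝ) :=
  continuous_snd.comp (continuous_induced_dom (f := coords p))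

theorem continuous_filiformExp_apply {X : Type*} [TopologicalSpace X] {f : X → ℝ}
    {g : X → Fin (p - 1) → ℝ} (hf : Continuous f) (hg : Continuous g) :
    Continuous fun x => filiformExp p (f x) (g x) := by
  simp only [filiformExp, LinearMap.sum_apply, LinearMap.smul_apply]
  refine continuous_finsetSum _ fun k _ => ?_
  exact ((hf.pow k).div_const _).smul
    ((LinearMap.continuous_of_finiteDimensional (filiformShift p ^ k)).comp hg)

instance : IsTopologicalGroup (FiliformGroup p) where
  continuous_mul := by
    refine continuous_induced_rng.2 (Continuous.prodMk ?_ ?_)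
    · exact (continuous_t.comp continuous_fst).add (continuous_t.comp continuous_snd)
    · exact (continuous_v.comp continuous_fst).add
        (continuous_filiformExp_apply (continuous_t.comp continuous_fst)
          (continuous_v.comp continuous_snd))
  continuous_inv := by
    refine continuous_induced_rng.2 (Continuous.prodMk ?_ ?_)
    · exact continuous_t.neg
    · exact (continuous_filiformExp_apply continuous_t.neg continuous_v).neg

/-- The element `z ^ c = exp (c x_p)` of `L_p`. -/
def zPow (p : ℕ) (c : ℝ) : FiliformGroup p := ⟨0, fun i => if (i : ℕ) + 2 = p then c else 0⟩

theorem filiformExp_zPow (s c : ℝ) : filiformExp p s (zPow p c).v = (zPow p c).v := by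
  rcases p with _ | p
  · exact Subsingleton.elim (α := Fin 0 → ℝ) _ _
  have h0 : filiformShift (p + 1) (zPow (p + 1) c).v = 0 := by
    funext i
    have hi := i.isLt
    by_cases h : (i : ℕ) = 0
    · simp [filiformShift, h]
    · have h' : ¬ ((i : ℕ) - 1 + 2 = p + 1) := by omega
      simp only [filiformShift, zPow, LinearMap.coe_mk, AddHom.coe_mk, h, dite_false, h',
        if_false, Pi.zero_apply]
  rw [filiformExp, Finset.sum_range_succ']
  simp [pow_succ, h0]

theorem zPow_mul_comm (c : ℝ) (a : FiliformGroup p) : zPow p c * a = a * zPow p c := by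
  ext1
  · simp [zPow]
  · rw [mul_v, mul_v, filiformExp_zPow]
    simp [zPow, filiformExp_zero, add_comm]

theorem zPow_add (c d : ℝ) : zPow p (c + d) = zPow p c * zPow p d := by
  ext1
  · simp [zPow]
  · rw [mul_v, filiformExp_zPow]
    funext i
    by_cases h : (i : ℕ) + 2 = p <;> simp [zPow, h]

theorem zPow_zero : zPow p 0 = 1 := by
  ext1
  · rfl
  · funext i
    simp [zPow]

end FiliformGroup

/-! ### The central products -/

/-- The central subgroup `{(exp (c x_p), exp (-c y_q)) : c ∈ ℝ}` of `L_p × L_q`. -/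
def antidiagonalCentre (p q : ℕ) : Subgroup (FiliformGroup p × FiliformGroup q) where
  carrier := {a | ∃ c : ℝ, a = (FiliformGroup.zPow p c, FiliformGroup.zPow q (-c))}
  one_mem' := ⟨0, by simp [FiliformGroup.zPow_zero, Prod.one_eq_mk]⟩
  mul_mem' := by
    rintro _ _ ⟨c, rfl⟩ ⟨d, rfl⟩
    exact ⟨c + d, by simp [neg_add, FiliformGroup.zPow_add, -neg_add_rev]⟩
  inv_mem' := by
    rintro _ ⟨c, rfl⟩
    refine ⟨-c, inv_eq_of_mul_eq_one_right ?_⟩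
    simp [← FiliformGroup.zPow_add, FiliformGroup.zPow_zero, Prod.one_eq_mk]

instance (p q : ℕ) : (antidiagonalCentre p q).Normal where
  conj_mem := by
    rintro _ ⟨c, rfl⟩ g
    refine ⟨c, ?_⟩
    ext1 <;> simp [← FiliformGroup.zPow_mul_comm]

/-- The group `G_{p,q}`: the central product of `L_p` and `L_q`, in which `exp (c x_p)` and
`exp (c y_q)` are identified for all `c`.  It is the simply connected Lie group of the central
product `𝔤_{p,q}` of `𝔩_p` and `𝔩_q`; it carries the quotient topology. -/
abbrev CentralProduct (p q : ℕ) : Type :=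
  (FiliformGroup p × FiliformGroup q) ⧸ antidiagonalCentre p q

/-! ### Compact presentations and Dehn functions -/

/-- The length of the freely reduced word that represents `w`. -/
noncomputable def wordLength {α : Type*} (w : FreeGroup α) : ℕ :=
  haveI := Classical.decEq α
  w.norm

/-- The epimorphism onto the group generated by `S` from the free group on `S`. -/
def evalWord {G : Type*} [Group G] (S : Set G) : FreeGroup S →* G :=
  FreeGroup.lift (fun s : S => (s : G))

/-- `⟨S | R⟩` is a compact presentation of `G`: the set `S` is a compact generating set, the
relators have bounded length, and their normal closure is the kernel of `F_S → G`. -/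
structure IsCompactPresentation {G : Type*} [Group G] [TopologicalSpace G] (S : Set G)
    (R : Set (FreeGroup S)) : Prop where
  isCompact : IsCompact S
  closure_eq_top : Subgroup.closure S = ⊤
  bounded : ∃ M : ℕ, ∀ r ∈ R, wordLength r ≤ M
  normalClosure_eq : Subgroup.normalClosure R = (evalWord S).ker

/-- `w` is a product of `k` conjugates `u⁻¹ r u` with `r ∈ R` or `r⁻¹ ∈ R`. -/
def HasFilling {α : Type*} (R : Set (FreeGroup α)) (w : FreeGroup α) (k : ℕ) : Prop :=
  ∃ u r : Fin k → FreeGroup α, (∀ i, r i ∈ R ∨ (r i)⁻¹ ∈ R) ∧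
    w = (List.ofFn fun i => (u i)⁻¹ * r i * u i).prod

/-- The area of `w`: the least `k` such that `w` is a product of `k` conjugates of elements of
`R` and their inverses (`⊤` if there is no such `k`). -/
noncomputable def area {α : Type*} (R : Set (FreeGroup α)) (w : FreeGroup α) : ℕ∞ :=
  ⨅ (k : ℕ) (_ : HasFilling R w k), (k : ℕ∞)

/-- The Dehn function of `⟨S | R⟩`: the supremum of the areas of the null-homotopic freely reduced
words of length at most `n`.  Its values are in `ℕ ∪ {∞}`. -/
noncomputable def dehnFunction {G : Type*} [Group G] (S : Set G) (R : Set (FreeGroup S))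
    (n : ℕ) : ℕ∞ :=
  ⨆ (w : FreeGroup S) (_ : evalWord S w = 1) (_ : wordLength w ≤ n), area R w

/-- The relation `f ≼ g` between functions on the non-negative integers: there is a constant `A`
with `f n ≤ A * g (A * n + A) + A` for all `n`. -/
def AsympLE (f g : ℕ → ℕ∞) : Prop :=
  ∃ A : ℕ, ∀ n : ℕ, f n ≤ (A : ℕ∞) * g (A * n + A) + (A : ℕ∞)

/-!
Let `ξ₁, …, ξ_p` be the left-invariant forms on `L_p` dual to `x₁, …, x_p`, and let `t` be the
coordinate along `x₁`, so that `ξ₁ = dt`. For `p ≥ 3` and any continuous `φ : ℝ → ℝ` the 2-form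
`φ(t) ξ₁ ∧ ξ_{p-1}` is closed, and it descends to `G_{p,q}`, because neither `t` nor `ξ_{p-1}` sees
the centre. Its norm is at most `sup |φ|`, so its integral over a disc is at most the area of the
disc times `sup |φ|`, up to a constant. The loop `[x₁ⁿ, [x₁ⁿ, …, [x₁ⁿ, x₂ⁿ]]]` with `p - 1`
commutators has length `O(n)` and stays in the region where `t = O(n)`. If `φ(t) = t` on the part
of this region with `t ≥ 0` and `φ` is truncated outside, then `sup |φ| = O(n)`, while the integral
is of order `n ^ p`. Hence the area is at least of order `n ^ (p - 1)`.

The proof is an algebraic version of this. The action `exp (y · ad x₁)` turns an element `v` of the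
abelian ideal into the polynomial in `y` that is its coordinate along `x_{p-1}`. This gives a
homomorphism `π` from `G_{p,q}` to the group `ℝ ⋉ (ℝ → ℝ)` of translations and functions on the
line. Replacing the function `Q` attached to each letter of a word by the convolution
`u ↦ ∫₀ᵘ φ(x) Q(u - x) dx`, a primitive of the 2-form, gives a homomorphism `convolutionHom` from
the free group to `ℝ ⋉ (ℝ → ℝ)`. It does not factor through `G_{p,q}`, but a word of bounded length
deviates from the convolution of the function of its value by `O(sup |φ|)`, uniformly on the line
(`exists_abs_convolutionDefect_le`). So a relator goes to a function bounded by `O(sup |φ|)`.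
Conjugation only translates this function, and therefore a product of `k` conjugates of relators
goes to a function bounded by `k * O(sup |φ|)` (`exists_abs_convolutionHom_f_le`). On the other
hand a commutator with `x₁ⁿ` acts on functions as a difference with step `n`, and the iterated
difference of the convolution of `x` and `x ^ (p - 3) / (p - 3)!`, which is `x ^ (p - 1) / (p - 1)!`,
is `n ^ (p - 1)`; the factor `n` of `x₂ⁿ` brings this to `n ^ p`.

For `p = q = 2` the group is `ℝ³`, and `ξ_{p-1}` coincides with `ξ₁`. There the form
`φ(t) ξ₁ ∧ ζ` with `ζ` dual to `x₂` is closed and serves in the same way.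
-/

open scoped commutatorElement

/-! ### Functions on the line and their translations -/

/-- The semidirect product of `ℝ` and the additive group of all functions `ℝ → ℝ`, on which `ℝ`
acts by translations: `t` sends `f` to `u ↦ f (u + t)`. -/
@[ext]
structure TranslationGroup where
  /-- the translation -/
  t : ℝ
  /-- the function -/
  f : ℝ → ℝ

namespace TranslationGroup

noncomputable instance : Mul TranslationGroup :=
  ⟨fun a b => ⟨a.t + b.t, fun u => a.f u + b.f (u + a.t)⟩⟩

noncomputable instance : One TranslationGroup := ⟨⟨0, fun _ => 0⟩⟩

noncomputable instance : Inv TranslationGroup := ⟨fun a => ⟨-a.t, fun u => -a.f (u - a.t)⟩⟩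

@[simp] theorem mul_t (a b : TranslationGroup) : (a * b).t = a.t + b.t := rfl

@[simp] theorem mul_f (a b : TranslationGroup) (u : ℝ) :
    (a * b).f u = a.f u + b.f (u + a.t) := rfl

@[simp] theorem one_t : (1 : TranslationGroup).t = 0 := rfl

@[simp] theorem one_f (u : ℝ) : (1 : TranslationGroup).f u = 0 := rfl

@[simp] theorem inv_t (a : TranslationGroup) : (a⁻¹).t = -a.t := rfl

@[simp] theorem inv_f (a : TranslationGroup) (u : ℝ) : (a⁻¹).f u = -a.f (u - a.t) := rfl

noncomputable instance : Group TranslationGroup :=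
  Group.ofLeftAxioms
    (fun a b c => by
      ext1
      · simp [add_assoc]
      · funext u; simp [add_assoc])
    (fun a => by
      ext1
      · simp
      · funext u; simp)
    (fun a => by
      ext1
      · simp
      · funext u; simp [sub_eq_add_neg])

theorem pow_t (a : TranslationGroup) (n : ℕ) : (a ^ n).t = n * a.t := by
  induction n with
  | zero => simp
  | succ n ih => rw [pow_succ, mul_t, ih]; push_cast; ring

theorem pow_f_of_t_eq_zero {a : TranslationGroup} (ha : a.t = 0) (n : ℕ) (u : ℝ) :
    (a ^ n).f u = n * a.f u := by
  induction n with
  | zero => simp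
  | succ n ih => rw [pow_succ, mul_f, ih, pow_t, ha]; push_cast; ring_nf

/-- The commutator of a translation by `t` with a pure function is the forward difference with
step `t`, whatever the function that comes with the translation. -/
theorem iterate_commutator (a : TranslationGroup) {b : TranslationGroup} (hb : b.t = 0) (m : ℕ) :
    (fun g => ⁅a, g⁆)^[m] b = ⟨0, (fwdDiff a.t)^[m] b.f⟩ := by
  induction m with
  | zero => ext1 <;> simp [hb]
  | succ m ih =>
    rw [Function.iterate_succ_apply', ih, Function.iterate_succ_apply', commutatorElement_def]
    ext1
    · simp
    · funext u
      simp [fwdDiff, sub_eq_add_neg]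

/-- In a product of `k` conjugates of pure functions of absolute value at most `c`, the function
has absolute value at most `k * c`, because conjugation only translates a pure function. -/
theorem abs_prod_conj_f_le {k : ℕ} {c : ℝ} (u r : Fin k → TranslationGroup)
    (ht : ∀ i, (r i).t = 0) (hf : ∀ i x, |(r i).f x| ≤ c) :
    (List.ofFn fun i => (u i)⁻¹ * r i * u i).prod.t = 0 ∧
      ∀ x, |(List.ofFn fun i => (u i)⁻¹ * r i * u i).prod.f x| ≤ k * c := by
  induction k with
  | zero => simp
  | succ k ih =>
    obtain ⟨h1, h2⟩ := ih (fun i => u i.succ) (fun i => r i.succ) (fun i => ht _) (fun i => hf _)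
    rw [List.ofFn_succ, List.prod_cons]
    refine ⟨by simp [h1, ht], fun x => ?_⟩
    have h3 : ((u 0)⁻¹ * r 0 * u 0).f x = (r 0).f (x - (u 0).t) := by
      simp [ht, sub_eq_add_neg]
    rw [mul_f, h3]
    refine (abs_add_le _ _).trans ((add_le_add (hf _ _) (h2 _)).trans_eq ?_)
    push_cast
    ring

end TranslationGroup

/-- If `f` is within `ε` of `u ^ m / m!` at the points `0, h, …, m * h`, its `m`-th difference with
step `h` is within `2 ^ m * ε` of that of `u ^ m / m!`, which is `h ^ m`. -/
theorem abs_fwdDiff_iter_sub_pow_le {f : ℝ → ℝ} {m : ℕ} {h ε : ℝ}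
    (hf : ∀ k ≤ m, |f (k * h) - (k * h) ^ m / m.factorial| ≤ ε) :
    |(fwdDiff h)^[m] f 0 - h ^ m| ≤ 2 ^ m * ε := by
  have h1 : h ^ m = ∑ k ∈ Finset.range (m + 1),
      ((-1 : ℝ) ^ (m - k) * m.choose k) * ((k * h) ^ m / m.factorial) := by
    have h2 := congrFun (fwdDiff_iter_eq_factorial (R := ℝ) (n := m)) 0
    rw [fwdDiff_iter_eq_sum_shift] at h2
    simp only [zsmul_eq_mul, zero_add, nsmul_eq_mul, mul_one] at h2
    push_cast at h2
    have h3 : (m.factorial : ℝ) ≠ 0 := by positivity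
    calc h ^ m = (m.factorial : ℝ) * (h ^ m / m.factorial) := by field_simp
      _ = _ := by
        have h4 : (m.factorial : ℝ) = ∑ k ∈ Finset.range (m + 1),
          ((-1 : ℝ) ^ (m - k) * m.choose k) * (k : ℝ) ^ m := by rw [h2]; simp
        nth_rw 1 [h4]
        rw [Finset.sum_mul]
        refine Finset.sum_congr rfl fun k _ => ?_
        rw [mul_pow]
        ring
  rw [fwdDiff_iter_eq_sum_shift, h1, ← Finset.sum_sub_distrib]
  refine (Finset.abs_sum_le_sum_abs _ _).trans ?_
  have h5 : (2 : ℝ) ^ m * ε = ∑ k ∈ Finset.range (m + 1), (m.choose k : ℝ) * ε := by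
    rw [← Finset.sum_mul]
    congr 1
    exact_mod_cast (Nat.sum_range_choose m).symm
  rw [h5]
  refine Finset.sum_le_sum fun k hk => ?_
  have hk' : k ≤ m := by simpa [Nat.lt_succ_iff] using hk
  have h6 : ((-1 : ℤ) ^ (m - k) * m.choose k) • f (0 + k • h) -
      ((-1 : ℝ) ^ (m - k) * m.choose k) * ((k * h) ^ m / m.factorial) =
      ((-1 : ℝ) ^ (m - k) * m.choose k) * (f (k * h) - (k * h) ^ m / m.factorial) := by
    simp only [zsmul_eq_mul, zero_add, nsmul_eq_mul]
    push_cast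
    ring
  rw [h6, abs_mul, abs_mul, abs_pow, abs_neg, abs_one, one_pow, one_mul, Nat.abs_cast]
  exact mul_le_mul_of_nonneg_left (hf k hk') (by positivity)

/-! ### Weighted convolutions along words -/

open TranslationGroup

/-- The convolution `u ↦ ∫₀ᵘ φ(x) Q(u - x) dx`. -/
noncomputable def halfConvolution (φ Q : ℝ → ℝ) (u : ℝ) : ℝ := ∫ x in (0 : ℝ)..u, φ x * Q (u - x)

theorem halfConvolution_id_pow (d : ℕ) {φ : ℝ → ℝ} {u : ℝ} (hu : 0 ≤ u)
    (hφ : ∀ x ∈ Set.Icc 0 u, φ x = x) :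
    halfConvolution φ (fun y => y ^ d / d.factorial) u = u ^ (d + 2) / (d + 2).factorial := by
  have h1 : halfConvolution φ (fun y => y ^ d / d.factorial) u =
      ∫ x in (0 : ℝ)..u, x * ((u - x) ^ d / d.factorial) := by
    refine intervalIntegral.integral_congr fun x hx => ?_
    rw [Set.uIcc_of_le hu] at hx
    simp only [hφ x hx]
  have h2 : ∀ x ∈ Set.uIcc 0 u, HasDerivAt
      (fun x => -(x * ((u - x) ^ (d + 1) / (d + 1).factorial)) -
        (u - x) ^ (d + 2) / (d + 2).factorial) (x * ((u - x) ^ d / d.factorial)) x := by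
    intro x _
    have h3 (j : ℕ) : HasDerivAt (fun x => (u - x) ^ (j + 1) / (j + 1).factorial)
        (-((u - x) ^ j / j.factorial)) x := by
      have h4 := (((hasDerivAt_id x).const_sub u).pow (j + 1)).div_const ((j + 1).factorial : ℝ)
      refine h4.congr_deriv ?_
      rw [Nat.factorial_succ]
      push_cast
      simp only [id]
      field_simp
    refine (((hasDerivAt_id x).mul (h3 d)).neg.sub (h3 (d + 1))).congr_deriv ?_
    simp only [id]
    ring
  rw [h1, intervalIntegral.integral_eq_sub_of_hasDerivAt h2
    (Continuous.intervalIntegrable (by fun_prop) _ _)]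
  simp

section words

variable {G : Type*} [Group G] (π : G →* TranslationGroup) (S : Set G) (φ : ℝ → ℝ)

/-- The homomorphism from the free group that sends the letter `s` to the translation of `π s`
together with the convolution of `φ` and the function of `π s`. It does not factor through `G`. -/
noncomputable def convolutionHom : FreeGroup S →* TranslationGroup :=
  FreeGroup.lift fun s : S => ⟨(π s).t, halfConvolution φ (π s).f⟩

theorem evalWord_of (s : S) : evalWord S (FreeGroup.of s) = s := FreeGroup.lift_apply_of

theorem convolutionHom_of (s : S) :
    convolutionHom π S φ (FreeGroup.of s) = ⟨(π s).t, halfConvolution φ (π s).f⟩ :=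
  FreeGroup.lift_apply_of

theorem convolutionHom_t (w : FreeGroup S) :
    (convolutionHom π S φ w).t = (π (evalWord S w)).t := by
  induction w using FreeGroup.induction_on with
  | C1 => simp
  | of s => rw [convolutionHom_of, evalWord_of]
  | inv_of s h => simp [h]
  | mul x y hx hy => simp [hx, hy]

/-- The deviation of the function attached to a word `w` from the convolution of `φ` and the
function of `π w`. -/
noncomputable def convolutionDefect (w : FreeGroup S) (u : ℝ) : ℝ :=
  (convolutionHom π S φ w).f u - halfConvolution φ (π (evalWord S w)).f u

variable {π S φ}

/-- Appending a letter changes the deviation by an integral over an interval whose length is the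
translation of the word. -/
theorem convolutionDefect_mul_of (hπ : ∀ g, Continuous (π g).f) (hφ : Continuous φ)
    (w : FreeGroup S) (s : S) (u : ℝ) :
    convolutionDefect π S φ (w * FreeGroup.of s) u = convolutionDefect π S φ w u +
      ∫ x in u..(u + (π (evalWord S w)).t), φ x * (π s).f (u + (π (evalWord S w)).t - x) := by
  have hs := hπ s
  have hw := hπ (evalWord S w)
  have h1 : halfConvolution φ (π (evalWord S (w * FreeGroup.of s))).f u =
      halfConvolution φ (π (evalWord S w)).f u +
        ∫ x in (0 : ℝ)..u, φ x * (π s).f (u + (π (evalWord S w)).t - x) := by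
    rw [halfConvolution, halfConvolution, ← intervalIntegral.integral_add
      (Continuous.intervalIntegrable (by fun_prop) _ _)
      (Continuous.intervalIntegrable (by fun_prop) _ _)]
    refine intervalIntegral.integral_congr fun x _ => ?_
    simp only [map_mul, evalWord_of, mul_f]
    rw [sub_add_eq_add_sub]
    ring
  have h2 := intervalIntegral.integral_add_adjacent_intervals (μ := MeasureTheory.volume)
    (f := fun x => φ x * (π s).f (u + (π (evalWord S w)).t - x)) (a := 0) (b := u)
    (c := u + (π (evalWord S w)).t) (Continuous.intervalIntegrable (by fun_prop) _ _)
    (Continuous.intervalIntegrable (by fun_prop) _ _)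
  rw [convolutionDefect, convolutionDefect, h1, map_mul, mul_f, convolutionHom_of,
    convolutionHom_t]
  simp only [halfConvolution]
  rw [← h2]
  ring

theorem convolutionDefect_one (u : ℝ) : convolutionDefect π S φ 1 u = 0 := by
  simp [convolutionDefect, halfConvolution]

variable (π) in
/-- The deviation of a word of bounded length is controlled by the supremum of `φ`, with a
constant that does not depend on `φ`. -/
theorem exists_abs_convolutionDefect_le [TopologicalSpace G] (hS : IsCompact S)
    (ht : Continuous fun g => (π g).t) (hf : Continuous fun x : G × ℝ => (π x.1).f x.2) (M : ℕ) :
    ∃ C : ℝ, 0 ≤ C ∧ ∀ (φ : ℝ → ℝ) (B : ℝ), Continuous φ → (∀ x, |φ x| ≤ B) →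
      ∀ w : FreeGroup S, wordLength w ≤ M → ∀ u, |convolutionDefect π S φ w u| ≤ C * B := by
  obtain ⟨T₀, hT₀⟩ := hS.exists_bound_of_continuousOn ht.continuousOn
  obtain ⟨T, hT0, hT⟩ : ∃ T, 0 ≤ T ∧ ∀ s ∈ S, |(π s).t| ≤ T :=
    ⟨max T₀ 0, le_max_right _ _, fun s hs => (hT₀ s hs).trans (le_max_left _ _)⟩
  obtain ⟨K₀, hK₀⟩ := (hS.prod
    (isCompact_Icc (a := -(M * T)) (b := M * T))).exists_bound_of_continuousOn hf.continuousOn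
  obtain ⟨K, hK0, hK⟩ : ∃ K, 0 ≤ K ∧ ∀ s ∈ S, ∀ y, |y| ≤ M * T → |(π s).f y| ≤ K :=
    ⟨max K₀ 0, le_max_right _ _, fun s hs y hy =>
      (hK₀ (s, y) ⟨hs, abs_le.1 hy⟩).trans (le_max_left _ _)⟩
  refine ⟨M * (K * (M * T)), by positivity, fun φ B hφ hB => ?_⟩
  have hB0 : 0 ≤ B := (abs_nonneg _).trans (hB 0)
  have hπ (g : G) : Continuous (π g).f := hf.comp (Continuous.prodMk_right g)
  have hJ (s : S) (u t : ℝ) (h : |t| ≤ M * T) :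
      |∫ x in u..(u + t), φ x * (π s).f (u + t - x)| ≤ K * (M * T) * B := by
    have h1 : ∀ x ∈ Set.uIoc u (u + t), ‖φ x * (π s).f (u + t - x)‖ ≤ B * K := by
      intro x hx
      rw [norm_mul]
      refine mul_le_mul (hB x) (hK s s.2 _ (le_trans ?_ h)) (norm_nonneg _) hB0
      have h2 := Set.abs_sub_right_of_mem_uIcc (Set.uIoc_subset_uIcc hx)
      simpa using h2
    have h3 := intervalIntegral.norm_integral_le_of_norm_le_const h1
    rw [add_sub_cancel_left, Real.norm_eq_abs] at h3
    calc _ ≤ B * K * |t| := h3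
      _ ≤ B * K * (M * T) := by gcongr
      _ = _ := by ring
  have key (l : List (S × Bool)) (hl : l.length ≤ M) :
      |(π (evalWord S (FreeGroup.mk l))).t| ≤ l.length * T ∧
        ∀ u, |convolutionDefect π S φ (FreeGroup.mk l) u| ≤ l.length * (K * (M * T) * B) := by
    induction l using List.reverseRecOn with
    | nil => simp [← FreeGroup.one_eq_mk, convolutionDefect_one]
    | append_singleton l a ih =>
      rw [List.length_append, List.length_singleton] at hl
      obtain ⟨h1, h2⟩ := ih (by omega)
      have hlM : ((l.length : ℝ) + 1) * T ≤ M * T := by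
        have : (l.length : ℝ) + 1 ≤ M := by exact_mod_cast hl
        gcongr
      obtain ⟨s, b⟩ := a
      have hs := hT s s.2
      rw [List.length_append, List.length_singleton, ← FreeGroup.mul_mk]
      push_cast
      cases b with
      | true =>
        change |(π (evalWord S (FreeGroup.mk l * FreeGroup.of s))).t| ≤ _ ∧
          ∀ u, |convolutionDefect π S φ (FreeGroup.mk l * FreeGroup.of s) u| ≤ _
        refine ⟨?_, fun u => ?_⟩
        · rw [map_mul, map_mul, mul_t, evalWord_of]
          refine (abs_add_le _ _).trans ?_
          linarith
        · rw [convolutionDefect_mul_of hπ hφ]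
          refine (abs_add_le _ _).trans ?_
          have := hJ s u _ (h1.trans (le_trans (by gcongr; linarith) hlM))
          linarith [h2 u]
      | false =>
        have h3 : FreeGroup.mk [(s, false)] = (FreeGroup.of s)⁻¹ := rfl
        rw [h3]
        have h4 : |(π (evalWord S (FreeGroup.mk l * (FreeGroup.of s)⁻¹))).t| ≤
            ((l.length : ℝ) + 1) * T := by
          rw [map_mul, map_mul, mul_t, map_inv, map_inv, inv_t, evalWord_of]
          refine (abs_add_le _ _).trans ?_
          rw [abs_neg]
          linarith
        refine ⟨h4, fun u => ?_⟩
        -- `mk l` is the product of the word at hand and the letter `s`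
        have h5 := convolutionDefect_mul_of hπ hφ (FreeGroup.mk l * (FreeGroup.of s)⁻¹) s u
        rw [inv_mul_cancel_right] at h5
        rw [← sub_eq_iff_eq_add] at h5
        rw [← h5]
        refine (abs_sub _ _).trans ?_
        linarith [h2 u, hJ s u _ (h4.trans hlM)]
  intro w hw u
  classical
  have hlen : w.toWord.length ≤ M := by
    have h : wordLength w = w.toWord.length := by
      unfold wordLength FreeGroup.norm
      congr!
    omega
  have h1 := (key w.toWord hlen).2 u
  rw [FreeGroup.mk_toWord] at h1
  refine h1.trans ?_
  rw [mul_assoc (M : ℝ)]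
  have : (w.toWord.length : ℝ) ≤ M := by exact_mod_cast hlen
  gcongr

end words

/-! ### Word length -/

section wordLength

variable {α : Type*}

theorem wordLength_eq_norm [DecidableEq α] (w : FreeGroup α) : wordLength w = w.norm := by
  unfold wordLength
  congr!

theorem wordLength_mul_le (v w : FreeGroup α) :
    wordLength (v * w) ≤ wordLength v + wordLength w := by
  classical
  simpa only [wordLength_eq_norm] using FreeGroup.norm_mul_le v w

theorem wordLength_inv (w : FreeGroup α) : wordLength w⁻¹ = wordLength w := by
  classical
  simp only [wordLength_eq_norm, FreeGroup.norm_inv_eq]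

theorem wordLength_pow_le (w : FreeGroup α) (n : ℕ) : wordLength (w ^ n) ≤ n * wordLength w := by
  classical
  induction n with
  | zero => simp [wordLength_eq_norm]
  | succ n ih =>
    rw [pow_succ, Nat.succ_mul]
    exact (wordLength_mul_le _ _).trans (Nat.add_le_add_right ih _)

theorem exists_wordLength_iterate_commutator_le (v w : FreeGroup α) (m : ℕ) :
    ∃ L : ℕ, ∀ n : ℕ, wordLength ((fun g => ⁅v ^ n, g⁆)^[m] (w ^ n)) ≤ L * n := by
  induction m with
  | zero => exact ⟨wordLength w, fun n => (wordLength_pow_le w n).trans_eq (mul_comm _ _)⟩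
  | succ m ih =>
    obtain ⟨L, hL⟩ := ih
    refine ⟨2 * wordLength v + 2 * L, fun n => ?_⟩
    rw [Function.iterate_succ_apply', commutatorElement_def]
    refine (wordLength_mul_le _ _).trans ?_
    rw [wordLength_inv]
    have h1 := wordLength_mul_le (v ^ n * (fun g => ⁅v ^ n, g⁆)^[m] (w ^ n)) (v ^ n)⁻¹
    have h2 := wordLength_mul_le (v ^ n) ((fun g => ⁅v ^ n, g⁆)^[m] (w ^ n))
    have h3 := wordLength_pow_le v n
    rw [wordLength_inv] at h1
    nlinarith [hL n]

end wordLength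

/-! ### The area of iterated commutators -/

section lowerBound

variable {G : Type*} [Group G] [TopologicalSpace G] {S : Set G} {R : Set (FreeGroup S)}

theorem map_iterate_commutator {H K : Type*} [Group H] [Group K] (f : H →* K) (a b : H) (m : ℕ) :
    f ((fun g => ⁅a, g⁆)^[m] b) = (fun g => ⁅f a, g⁆)^[m] (f b) := by
  induction m with
  | zero => rfl
  | succ m ih => rw [Function.iterate_succ_apply', Function.iterate_succ_apply',
      map_commutatorElement, ih]

/-- A filling of `w` by `k` relators bounds the function attached to `w` by `k` times the supremum
of `φ`, up to a constant that does not depend on `φ`. -/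
theorem exists_abs_convolutionHom_f_le (hSR : IsCompactPresentation S R)
    (π : G →* TranslationGroup) (ht : Continuous fun g => (π g).t)
    (hf : Continuous fun x : G × ℝ => (π x.1).f x.2) :
    ∃ C : ℝ, 0 ≤ C ∧ ∀ (φ : ℝ → ℝ) (B : ℝ), Continuous φ → (∀ x, |φ x| ≤ B) →
      ∀ (w : FreeGroup S) (k : ℕ), HasFilling R w k →
        ∀ u, |(convolutionHom π S φ w).f u| ≤ k * (C * B) := by
  obtain ⟨M, hM⟩ := hSR.bounded
  obtain ⟨C, hC0, hC⟩ := exists_abs_convolutionDefect_le π hSR.isCompact ht hf M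
  refine ⟨C, hC0, fun φ B hφ hB w k hw x => ?_⟩
  obtain ⟨u, r, hr, rfl⟩ := hw
  have hr1 (i : Fin k) : evalWord S (r i) = 1 ∧ wordLength (r i) ≤ M := by
    have h (v : FreeGroup S) (hv : v ∈ R) : evalWord S v = 1 := by
      rw [← MonoidHom.mem_ker, ← hSR.normalClosure_eq]
      exact Subgroup.subset_normalClosure hv
    rcases hr i with h1 | h1
    · exact ⟨h _ h1, hM _ h1⟩
    · exact ⟨by simpa using h _ h1, by simpa [wordLength_inv] using hM _ h1⟩
  have h1 := (abs_prod_conj_f_le (c := C * B) (fun i => convolutionHom π S φ (u i))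
    (fun i => convolutionHom π S φ (r i))
    (fun i => by rw [convolutionHom_t, (hr1 i).1, map_one, one_t]) (fun i x => by
      have h2 := hC φ B hφ hB (r i) (hr1 i).2 x
      have h3 : halfConvolution φ (π (evalWord S (r i))).f x = 0 := by
        simp [(hr1 i).1, halfConvolution]
      rwa [convolutionDefect, h3, sub_zero] at h2)).2 x
  convert h1 using 3
  rw [map_list_prod, List.map_ofFn]
  simp [Function.comp_def]

/-- Iterated commutators of `x₁ ^ n` with `x₂ ^ n` have area at least of order `n ^ (d + 2)`, when
`x₁` acts as the unit translation and `x₂` as the function `y ^ d / d!`. -/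
theorem asympLE_dehnFunction_of_translation (hSR : IsCompactPresentation S R)
    (π : G →* TranslationGroup) (ht : Continuous fun g => (π g).t)
    (hf : Continuous fun x : G × ℝ => (π x.1).f x.2) (d : ℕ) (x₁ x₂ : G)
    (h₁ : (π x₁).t = 1) (h₂ : (π x₂).t = 0) (h₂' : ∀ y, (π x₂).f y = y ^ d / d.factorial)
    (hcomm : ∀ n : ℕ, (fun g => ⁅x₁ ^ n, g⁆)^[d + 2] (x₂ ^ n) = 1) :
    AsympLE (fun n => (n : ℕ∞) ^ (d + 2)) (dehnFunction S R) := by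
  have hsurj : Function.Surjective (evalWord S) := by
    rw [← MonoidHom.range_eq_top, evalWord, FreeGroup.range_lift_eq_closure,
      Subtype.range_coe, hSR.closure_eq_top]
  obtain ⟨X₁, rfl⟩ := hsurj x₁
  obtain ⟨X₂, rfl⟩ := hsurj x₂
  obtain ⟨C₁, hC₁0, hC₁⟩ :=
    exists_abs_convolutionDefect_le π hSR.isCompact ht hf (wordLength X₂)
  obtain ⟨C₂, hC₂0, hC₂⟩ := exists_abs_convolutionHom_f_le hSR π ht hf
  obtain ⟨L, hL⟩ := exists_wordLength_iterate_commutator_le X₁ X₂ (d + 2)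
  set W : ℕ → FreeGroup S := fun n => (fun g => ⁅X₁ ^ n, g⁆)^[d + 2] (X₂ ^ n) with hW
  have hW1 (n : ℕ) : evalWord S (W n) = 1 := by
    rw [hW, map_iterate_commutator, map_pow, map_pow, hcomm]
  obtain ⟨D, hD₁, hD₂⟩ : ∃ D : ℕ, 2 ^ (d + 2) * (C₁ * (d + 2 : ℕ)) ≤ D ∧ C₂ * (d + 2 : ℕ) ≤ D := by
    obtain ⟨D, hD⟩ := exists_nat_ge (max (2 ^ (d + 2) * (C₁ * (d + 2 : ℕ))) (C₂ * (d + 2 : ℕ)))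
    exact ⟨D, (le_max_left _ _).trans hD, (le_max_right _ _).trans hD⟩
  have hfill (n k : ℕ) (hk : HasFilling R (W n) k) : n ^ (d + 2) ≤ D * n + D * k := by
    rcases Nat.eq_zero_or_pos n with rfl | hn
    · simp
    have hn' : (0 : ℝ) < n := by exact_mod_cast hn
    -- the weight `φ` is the identity on the range of the iterated difference, and is truncated
    -- outside of it, so that its supremum is linear in `n`
    set B : ℝ := (d + 2 : ℕ) * n with hB
    set φ : ℝ → ℝ := fun x => max 0 (min x B) with hφ
    have hB0 : 0 ≤ B := by positivity
    have hφc : Continuous φ := by fun_prop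
    have hφB (x : ℝ) : |φ x| ≤ B := by
      rw [abs_of_nonneg (le_max_left _ _)]
      exact max_le hB0 (min_le_right _ _)
    have hφid {x : ℝ} (h0 : 0 ≤ x) (h1 : x ≤ B) : φ x = x := by
      simp only [hφ, min_eq_left h1, max_eq_right h0]
    have hX₂ : (convolutionHom π S φ X₂).t = 0 := by rw [convolutionHom_t, h₂]
    have hval : (convolutionHom π S φ (W n)).f 0 =
        n * (fwdDiff (n : ℝ))^[d + 2] (convolutionHom π S φ X₂).f 0 := by
      have h3 : (convolutionHom π S φ X₂ ^ n).f = (n : ℝ) • (convolutionHom π S φ X₂).f := by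
        funext u
        simp [pow_f_of_t_eq_zero hX₂]
      rw [hW, map_iterate_commutator, map_pow, map_pow,
        iterate_commutator _ (by rw [pow_t, hX₂, mul_zero]), h3, fwdDiff_iter_const_smul,
        pow_t, convolutionHom_t, h₁, mul_one]
      simp
    have hdiff := abs_fwdDiff_iter_sub_pow_le (f := (convolutionHom π S φ X₂).f) (m := d + 2)
      (h := n) (ε := C₁ * B) (fun k hk => by
        have hkB : (k * n : ℝ) ≤ B := by
          rw [hB]
          gcongr
        have h4 := hC₁ φ B hφc hφB X₂ le_rfl (k * n)
        rwa [convolutionDefect, funext h₂', halfConvolution_id_pow d (by positivity)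
          fun x hx => hφid hx.1 (hx.2.trans hkB)] at h4)
    have hub := hC₂ φ B hφc hφB (W n) k hk 0
    rw [hval, abs_mul, Nat.abs_cast] at hub
    have h5 : |(fwdDiff (n : ℝ))^[d + 2] (convolutionHom π S φ X₂).f 0| ≤
        k * (C₂ * (d + 2 : ℕ)) := by
      refine le_of_mul_le_mul_left (hub.trans_eq ?_) hn'
      rw [hB]
      ring
    have h6 : (n : ℝ) ^ (d + 2) ≤ D * n + D * k := by
      have h7 := (abs_le.1 hdiff).1
      have h8 := (abs_le.1 h5).2
      have h9 : 2 ^ (d + 2) * (C₁ * B) = 2 ^ (d + 2) * (C₁ * (d + 2 : ℕ)) * n := by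
        rw [hB]
        ring
      have h10 := mul_le_mul_of_nonneg_right hD₁ hn'.le
      have h11 := mul_le_mul_of_nonneg_left hD₂ (Nat.cast_nonneg (α := ℝ) k)
      linarith
    exact_mod_cast h6
  -- the linear error is absorbed: it is at most half of the main term once `n ≥ 2 * D`
  have hfill' (n k : ℕ) (hk : HasFilling R (W n) k) :
      n ^ (d + 2) ≤ 2 * D * k + (2 * D) ^ (d + 2) := by
    rcases le_total (2 * D) n with h | h
    · have h1 := hfill n k hk
      have h2 : 2 * D * n ≤ n ^ (d + 2) := by
        rcases Nat.eq_zero_or_pos n with rfl | hn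
        · simp
        calc 2 * D * n ≤ n * n := Nat.mul_le_mul_right _ h
          _ = n ^ 2 := (sq n).symm
          _ ≤ n ^ (d + 2) := Nat.pow_le_pow_right hn (by omega)
      have h3 : n ^ (d + 2) ≤ 2 * D * k := by linarith
      exact h3.trans (Nat.le_add_right _ _)
    · exact (Nat.pow_le_pow_left h _).trans (Nat.le_add_left _ _)
  refine ⟨2 * D + (2 * D) ^ (d + 2) + L + 1, fun n => ?_⟩
  set A : ℕ := 2 * D + (2 * D) ^ (d + 2) + L + 1 with hA
  have harea : area R (W n) ≤ dehnFunction S R (A * n + A) := by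
    refine le_iSup₂_of_le (W n) (hW1 n) (le_iSup_of_le ?_ le_rfl)
    refine (hL n).trans ((Nat.mul_le_mul_right n ?_).trans (Nat.le_add_right _ _))
    omega
  refine le_trans ?_ (add_le_add_left (mul_le_mul_right harea (A : ℕ∞)) _)
  by_cases h : ∃ k, HasFilling R (W n) k
  · obtain ⟨k, hk, hk'⟩ : ∃ k, HasFilling R (W n) k ∧ area R (W n) = k := by
      classical
      refine ⟨Nat.find h, Nat.find_spec h, le_antisymm (iInf₂_le _ (Nat.find_spec h)) ?_⟩
      exact le_iInf₂ fun k hk => by exact_mod_cast Nat.find_min' h hk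
    rw [hk']
    have h1 := hfill' n k hk
    have h2 : n ^ (d + 2) ≤ A * k + A := by
      have : 2 * D * k ≤ A * k := Nat.mul_le_mul_right k (by omega)
      omega
    beta_reduce
    exact_mod_cast h2
  · have h1 : area R (W n) = ⊤ := by
      simp only [area, iInf_eq_top]
      exact fun k hk => absurd ⟨k, hk⟩ h
    rw [h1, ENat.mul_top (by simp [hA])]
    simp

end lowerBound

/-! ### Coordinates on the filiform groups and on their central products -/

theorem filiformShift_pow_apply (p k : ℕ) (v : Fin (p - 1) → ℝ) (i : Fin (p - 1))
    (hi : k ≤ (i : ℕ)) :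
    (filiformShift p ^ k) v i = v ⟨(i : ℕ) - k, by have := i.isLt; omega⟩ := by
  induction k generalizing i with
  | zero => rfl
  | succ k ih =>
    have h : (i : ℕ) ≠ 0 := by omega
    rw [pow_succ', Module.End.mul_apply]
    simp only [filiformShift, LinearMap.coe_mk, AddHom.coe_mk, h, dite_false]
    exact (ih ⟨(i : ℕ) - 1, _⟩ (by simp only; omega)).trans
      (congrArg v (Fin.ext (by simp only; omega)))

theorem filiformExp_apply (p : ℕ) (t : ℝ) (v : Fin (p - 1) → ℝ) (i : Fin (p - 1)) :
    filiformExp p t v i =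
      ∑ k ∈ Finset.range p, t ^ k / (k.factorial : ℝ) * (filiformShift p ^ k) v i := by
  simp [filiformExp, Finset.sum_apply]

theorem filiformExp_apply_of_eq_zero {p : ℕ} (t : ℝ) {v : Fin (p - 1) → ℝ} {i : Fin (p - 1)}
    (hv : ∀ j < i, v j = 0) : filiformExp p t v i = v i := by
  have hp : 0 < p := by have := i.isLt; omega
  rw [filiformExp_apply, Finset.sum_eq_single_of_mem 0 (Finset.mem_range.2 hp)]
  · simp
  · intro k _ hk
    rcases lt_or_ge (i : ℕ) k with h | h
    · rw [filiformShift_pow_apply_eq_zero p k v i h, mul_zero]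
    · rw [filiformShift_pow_apply p k v i h, hv _ (Fin.lt_def.2 (by simp only; omega)), mul_zero]

theorem filiformExp_apply_leading (p : ℕ) (t : ℝ) (i : Fin (p - 1)) :
    filiformExp p t (fun j => if (j : ℕ) = 0 then 1 else 0) i =
      t ^ (i : ℕ) / ((i : ℕ).factorial : ℝ) := by
  have hi := i.isLt
  rw [filiformExp_apply, Finset.sum_eq_single_of_mem (i : ℕ) (Finset.mem_range.2 (by omega))]
  · rw [filiformShift_pow_apply p _ _ i le_rfl]
    simp
  · intro k _ hk
    rcases lt_or_ge (i : ℕ) k with h | h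
    · rw [filiformShift_pow_apply_eq_zero p k _ i h, mul_zero]
    · rw [filiformShift_pow_apply p k _ i h, if_neg (by simp only; omega), mul_zero]

namespace FiliformGroup

/-- The homomorphism from `L_p` that records the coordinate `x₁` together with the polynomial
`y ↦ (exp (y · ad x₁) v)_i`; translating the polynomial by `t` amounts to acting on `v` by
`exp (t · ad x₁)`. -/
noncomputable def polynomialHom (p : ℕ) (i : Fin (p - 1)) :
    FiliformGroup p →* TranslationGroup where
  toFun a := ⟨a.t, fun y => filiformExp p y a.v i⟩
  map_one' := by
    ext1
    · rfl
    · funext y; simp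
  map_mul' a b := by
    ext1
    · rfl
    · funext y; simp [filiformExp_add]

variable (p : ℕ)

/-- The element `exp x₁`. -/
def expX₁ : FiliformGroup p := ⟨1, 0⟩

/-- The element `exp x₂`. -/
def expX₂ : FiliformGroup p := ⟨0, fun j => if (j : ℕ) = 0 then 1 else 0⟩

theorem expX₁_pow (n : ℕ) : expX₁ p ^ n = ⟨n, 0⟩ := by
  induction n with
  | zero => ext1 <;> simp
  | succ n ih => rw [pow_succ, ih]; ext1 <;> simp [expX₁]

theorem pow_t_eq_zero {a : FiliformGroup p} (ha : a.t = 0) (n : ℕ) : (a ^ n).t = 0 := by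
  induction n with
  | zero => simp
  | succ n ih => rw [pow_succ, mul_t, ih, ha, add_zero]

/-- Each commutator with a power of `exp x₁` kills one more coordinate. -/
theorem iterate_commutator_expX₁ (n : ℕ) {a : FiliformGroup p} (ha : a.t = 0) (m : ℕ) :
    ((fun g => ⁅expX₁ p ^ n, g⁆)^[m] a).t = 0 ∧
      ∀ i : Fin (p - 1), (i : ℕ) < m → ((fun g => ⁅expX₁ p ^ n, g⁆)^[m] a).v i = 0 := by
  induction m with
  | zero => simp [ha]
  | succ m ih =>
    obtain ⟨h1, h2⟩ := ih
    rw [Function.iterate_succ_apply', commutatorElement_def, expX₁_pow] at *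
    generalize (fun g => ⁅(⟨n, 0⟩ : FiliformGroup p), g⁆)^[m] a = b at *
    refine ⟨by simp [h1], fun i hi => ?_⟩
    have h3 : filiformExp p n b.v i = b.v i :=
      filiformExp_apply_of_eq_zero _ fun j hj => h2 j (by have := Fin.lt_def.1 hj; omega)
    simp [h1, h3, filiformExp_zero]

theorem iterate_commutator_expX₁_eq_one (n : ℕ) {a : FiliformGroup p} (ha : a.t = 0) {m : ℕ}
    (hm : p - 1 ≤ m) : (fun g => ⁅expX₁ p ^ n, g⁆)^[m] a = 1 := by
  obtain ⟨h1, h2⟩ := iterate_commutator_expX₁ p n ha m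
  ext1
  · exact h1
  · funext i
    exact h2 i (i.isLt.trans_le hm)

end FiliformGroup

namespace CentralProduct

open FiliformGroup

variable {p q : ℕ}

theorem iterate_commutator_eq_one (n : ℕ) {m : ℕ} (hm : p - 1 ≤ m) :
    (fun g => ⁅(((expX₁ p, 1) : FiliformGroup p × FiliformGroup q) : CentralProduct p q) ^ n, g⁆)^[m]
      ((((expX₂ p, 1) : FiliformGroup p × FiliformGroup q) : CentralProduct p q) ^ n) = 1 := by
  have h := map_iterate_commutator ((QuotientGroup.mk' (antidiagonalCentre p q)).comp
    (MonoidHom.inl (FiliformGroup p) (FiliformGroup q))) (expX₁ p ^ n) (expX₂ p ^ n) m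
  rw [iterate_commutator_expX₁_eq_one p n (pow_t_eq_zero p rfl n) hm, map_one, map_pow,
    map_pow] at h
  exact h.symm

/-- The lower bound for `G_{p,q}` from a homomorphism on `L_p × L_q` that is trivial on the
antidiagonal centre. -/
theorem asympLE_dehnFunction {S : Set (CentralProduct p q)} {R : Set (FreeGroup S)}
    (hSR : IsCompactPresentation S R) (π : FiliformGroup p × FiliformGroup q →* TranslationGroup)
    (hker : ∀ c : ℝ, π (zPow p c, zPow q (-c)) = 1) (ht : Continuous fun g => (π g).t)
    (hf : Continuous fun x : (FiliformGroup p × FiliformGroup q) × ℝ => (π x.1).f x.2)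
    (d : ℕ) (hd : p - 1 ≤ d + 2) (h₁ : (π (expX₁ p, 1)).t = 1) (h₂ : (π (expX₂ p, 1)).t = 0)
    (h₂' : ∀ y, (π (expX₂ p, 1)).f y = y ^ d / d.factorial) :
    AsympLE (fun n => (n : ℕ∞) ^ (d + 2)) (dehnFunction S R) := by
  have hN : antidiagonalCentre p q ≤ π.ker := by
    rintro _ ⟨c, rfl⟩
    exact hker c
  have hmk : IsOpenQuotientMap
      (QuotientGroup.mk : FiliformGroup p × FiliformGroup q → CentralProduct p q) :=
    QuotientGroup.isOpenQuotientMap_mk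
  exact asympLE_dehnFunction_of_translation hSR
    (QuotientGroup.lift (antidiagonalCentre p q) π hN)
    (hmk.continuous_comp_iff.1 ht)
    ((hmk.prodMap IsOpenQuotientMap.id).continuous_comp_iff.1 hf)
    d _ _ h₁ h₂ h₂' fun n => iterate_commutator_eq_one n hd

end CentralProduct

open FiliformGroup

theorem theorem8p1 (p q : ℕ) (hq : 2 ≤ q) (hpq : q ≤ p)
    (S : Set (CentralProduct p q)) (R : Set (FreeGroup S)) (hSR : IsCompactPresentation S R) :
    AsympLE (fun n => (n : ℕ∞) ^ (p - 1)) (dehnFunction S R) := by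
  rcases Nat.eq_or_lt_of_le (hq.trans hpq) with rfl | hp
  · obtain rfl : q = 2 := by omega
    have hexp (t : ℝ) (v : Fin (2 - 1) → ℝ) : filiformExp 2 t v 0 = v 0 :=
      filiformExp_apply_of_eq_zero t fun j hj => absurd hj (by simp)
    -- the coordinate along the common centre is itself a homomorphism
    let π : FiliformGroup 2 × FiliformGroup 2 →* TranslationGroup :=
      { toFun := fun a => ⟨a.1.t, fun _ => a.1.v 0 + a.2.v 0⟩
        map_one' := by
          ext1
          · rfl
          · funext y; simp
        map_mul' := fun a b => by
          ext1
          · rfl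
          · funext y; simp [hexp]; ring }
    have hv : Continuous fun a : FiliformGroup 2 => a.v 0 := (continuous_apply 0).comp continuous_v
    obtain ⟨A, hA⟩ := CentralProduct.asympLE_dehnFunction hSR π
      (fun c => by
        ext1
        · rfl
        · funext y; simp [π, zPow])
      (continuous_t.comp continuous_fst)
      ((hv.comp (continuous_fst.comp continuous_fst)).add
        (hv.comp (continuous_snd.comp continuous_fst)))
      0 (by omega) rfl rfl (fun y => by simp [π, expX₂])
    refine ⟨A, fun n => le_trans ?_ (hA n)⟩
    have h : n ^ (2 - 1) ≤ n ^ (0 + 2) := by simpa [sq] using Nat.le_mul_self n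
    beta_reduce
    exact_mod_cast h
  · obtain ⟨d, rfl⟩ : ∃ d, p = d + 3 := ⟨p - 3, by omega⟩
    have hv : Continuous fun a : FiliformGroup (d + 3) × FiliformGroup q => a.1.v :=
      continuous_v.comp continuous_fst
    -- the coordinate with index `d` is the one along `x_{p-1}`, which does not see the centre
    exact CentralProduct.asympLE_dehnFunction hSR
      ((polynomialHom (d + 3) ⟨d, by omega⟩).comp (MonoidHom.fst _ _))
      (fun c => by
        ext1
        · rfl
        · funext y
          change filiformExp (d + 3) y (zPow (d + 3) c).v _ = 0
          rw [filiformExp_zPow]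
          simp [zPow])
      (continuous_t.comp continuous_fst)
      ((continuous_apply _).comp
        (continuous_filiformExp_apply continuous_snd (hv.comp continuous_fst)))
      d (by omega) rfl rfl fun y => filiformExp_apply_leading _ _ _
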